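/- Let $G$ be a countable discrete group (for instance, a finitely generated amenable infinite group), let $\mathcal S=M_d(\mathbb C)$ with $d\ge 1$, and let $\mathcal S^{\otimes G}$ be the UHF algebra of quasi-local observables. For a finite subset $\Lambda\subset G$ let $\mathcal S_\Lambda\simeq\mathcal S^{\otimes\Lambda}$ be the subalgebra of observables localized in $\Lambda$; these subalgebras have dense union. Put $g\cdot\Lambda:=\Lambda g^{-1}$, and let $\alpha$ be the action of $G$ on $\mathcal S^{\otimes G}$ which translates the sites by $x\mapsto xg^{-1}$, so that $\alpha_g(\mathcal S_\Lambda)=\mathcal S_{g\cdot\Lambda}$. A frustration-free proper system of projections is a family $\{p_\Lambda\}$, indexed by the finite subsets $\Lambda$ of $G$, of projections $p_\Lambda\in\mathcal S_\Lambda$ such that $p_\Lambda<1$ for all $\Lambda$ and $p_{\Lambda_1}p_{\Lambda_2}=p_{\Lambda_2}p_{\Lambda_1}=p_{\Lambda_1}$ whenever $\Lambda_1\subseteq\Lambda_2$. The set $\mathfrak F(\mathcal S^{\otimes G})$ of these systems is ordered by $\{p_\Lambda\}\le\{q_\Lambda\}$ iff $p_\Lambda\le q_\Lambda$ for all $\Lambda$,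 and $G$ acts on it by $g\cdot\{p_\Lambda\}=\{\alpha_g(p_{g^{-1}\cdot\Lambda})\}$. A $C^*$-subalgebra $\mathcal B\subseteq\mathcal S^{\otimes G}$ is hereditary if $0\le a\le b$ with $b\in\mathcal B$ implies $a\in\mathcal B$, and has property (F) if $\mathcal B=\overline{\bigcup_\Lambda(\mathcal B\cap\mathcal S_\Lambda)}$. Let $\mathfrak H^F(\mathcal S^{\otimes G})$ be the set of the hereditary $C^*$-subalgebras $\mathcal B\ne\mathcal S^{\otimes G}$ with property (F), ordered by inclusion and with the $G$-action $g\cdot\mathcal B=\alpha_g(\mathcal B)$. Theorem. (1) For every $\mathcal B\in\mathfrak H^F(\mathcal S^{\otimes G})$ and every finite $\Lambda\subset G$ there is a unique projection $p_\Lambda(\mathcal B)\in\mathcal S_\Lambda$ with $\mathcal B\cap\mathcal S_\Lambda=p_\Lambda(\mathcal B)\,\mathcal S_\Lambda\,p_\Lambda(\mathcal B)$. The family $\{p_\Lambda(\mathcal B)\}$ belongs to $\mathfrak F(\mathcal S^{\otimes G})$ and is an approximate unit of $\mathcal B$, i.e. $p_\Lambda(\mathcal B)\,b\to b$ and $b\,p_\Lambda(\mathcal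 B)\to b$ along the directed set of finite $\Lambda\subset G$ for every $b\in\mathcal B$. The map $\mathfrak p:\mathfrak H^F(\mathcal S^{\otimes G})\to\mathfrak F(\mathcal S^{\otimes G})$, $\mathcal B\mapsto\{p_\Lambda(\mathcal B)\}$, is an injective and $G$-equivariant morphism of posets. (2) There is a $G$-equivariant morphism of posets $\mathfrak p^{-1}:\mathfrak F(\mathcal S^{\otimes G})\to\mathfrak H^F(\mathcal S^{\otimes G})$ such that, for every $\{p_\Lambda\}\in\mathfrak F(\mathcal S^{\otimes G})$ and every increasing sequence $\Lambda_1\subseteq\Lambda_2\subseteq\cdots$ of finite subsets with $\bigcup_m\Lambda_m=G$, the series $w=\sum_{m=1}^\infty 2^{-m}p_{\Lambda_m}$ converges in norm and $\mathfrak p^{-1}(\{p_\Lambda\})=\overline{w\,\mathcal S^{\otimes G}\,w}$. It is a left inverse of $\mathfrak p$: $\mathfrak p^{-1}\circ\mathfrak p=\mathrm{id}$. -/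

import Mathlib

noncomputable section

namespace SpinSystem

open scoped Classical in
/-- The configuration which agrees with `v` on `Λ` and with `j` off `Λ`. -/
def override {d : ℕ} {G : Type*} (Λ : Finset G) (v : Λ → Fin d) (j : G → Fin d) : G → Fin d :=
  fun x => if h : x ∈ Λ then v ⟨x, h⟩ else j x

/-- The restriction of a configuration to `Λ`. -/
def restr {d : ℕ} {G : Type*} (Λ : Finset G) (j : G → Fin d) : Λ → Fin d := fun x => j x

lemma restr_override {d : ℕ} {G : Type*} (Λ : Finset G) (v : Λ → Fin d) (j : G → Fin d) :
    restr Λ (override Λ v j) = v := by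
  funext x; simp [restr, override]

lemma override_override {d : ℕ} {G : Type*} (Λ : Finset G) (v w : Λ → Fin d) (j : G → Fin d) :
    override Λ v (override Λ w j) = override Λ v j := by
  funext x; simp only [override]; split_ifs <;> rfl

lemma override_restr {d : ℕ} {G : Type*} (Λ : Finset G) (j : G → Fin d) :
    override Λ (restr Λ j) j = j := by
  funext x; simp only [override, restr]; split_ifs <;> rfl

/-- The Hilbert space with orthonormal basis the spin configurations `{1, …, d}^G`. -/
abbrev ConfigSpace (d : ℕ) (G : Type*) : Type _ := lp (fun _ : G → Fin d => ℂ) 2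

/-- `ψ ↦ c · (ψ ∘ σ)` for a function `c` bounded by one and a permutation `σ` of the
configurations. -/
def compOp {d : ℕ} {G : Type*} (c : (G → Fin d) → ℂ) (hc : ∀ j, ‖c j‖ ≤ 1)
    (σ : Equiv.Perm (G → Fin d)) : ConfigSpace d G →L[ℂ] ConfigSpace d G :=
  have two : (0 : ℝ) < (2 : ENNReal).toReal := by norm_num
  have bd : ∀ (ψ : ConfigSpace d G) (j : G → Fin d),
      ‖c j * ψ (σ j)‖ ^ (2 : ENNReal).toReal ≤ ‖ψ (σ j)‖ ^ (2 : ENNReal).toReal := fun ψ j => by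
    refine Real.rpow_le_rpow (norm_nonneg _) ?_ two.le
    rw [norm_mul]
    exact mul_le_of_le_one_left (norm_nonneg _) (hc j)
  have summ : ∀ ψ : ConfigSpace d G, Summable fun j => ‖ψ (σ j)‖ ^ (2 : ENNReal).toReal :=
    fun ψ => (σ.summable_iff (f := fun j => ‖ψ j‖ ^ (2 : ENNReal).toReal)).2
      ((lp.memℓp ψ).summable two)
  have summ' : ∀ ψ : ConfigSpace d G,
      Summable fun j => ‖c j * ψ (σ j)‖ ^ (2 : ENNReal).toReal := fun ψ =>
    Summable.of_nonneg_of_le (fun j => by positivity) (bd ψ) (summ ψ)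
  LinearMap.mkContinuous
    { toFun := fun ψ => ⟨fun j => c j * ψ (σ j), memℓp_gen (summ' ψ)⟩
      map_add' := fun ψ φ => by
        ext j; exact mul_add _ _ _
      map_smul' := fun a ψ => by
        ext j; simp [mul_left_comm] }
    1 (fun ψ => by
      rw [one_mul]
      refine lp.norm_le_of_tsum_le two (norm_nonneg _) ?_
      rw [lp.norm_rpow_eq_tsum two ψ, ← σ.tsum_eq (fun j => ‖ψ j‖ ^ (2 : ENNReal).toReal)]
      exact (summ' ψ).tsum_le_tsum (bd ψ) (summ ψ))

lemma compOp_apply {d : ℕ} {G : Type*} (c : (G → Fin d) → ℂ) (hc : ∀ j, ‖c j‖ ≤ 1)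
    (σ : Equiv.Perm (G → Fin d)) (ψ : ConfigSpace d G) (j : G → Fin d) :
    compOp c hc σ ψ j = c j * ψ (σ j) := rfl

open scoped Classical in
/-- The permutation of the configurations which exchanges `u` and `v` inside `Λ`. -/
def swapConfig {d : ℕ} {G : Type*} (Λ : Finset G) (u v : Λ → Fin d) :
    Equiv.Perm (G → Fin d) where
  toFun j := override Λ (Equiv.swap u v (restr Λ j)) j
  invFun j := override Λ (Equiv.swap u v (restr Λ j)) j
  left_inv j := by
    simp only [restr_override, override_override, Equiv.swap_apply_self, override_restr]
  right_inv j := by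
    simp only [restr_override, override_override, Equiv.swap_apply_self, override_restr]

open scoped Classical in
/-- The matrix unit `|u⟩⟨v|` at the sites of `Λ`, acting on the configuration space. -/
def unitOp {d : ℕ} {G : Type*} (Λ : Finset G) (u v : Λ → Fin d) :
    ConfigSpace d G →L[ℂ] ConfigSpace d G :=
  compOp (fun j => if restr Λ j = u then 1 else 0) (fun j => by split_ifs <;> simp)
    (swapConfig Λ u v)

open scoped Classical in
lemma unitOp_apply {d : ℕ} {G : Type*} (Λ : Finset G) (u v : Λ → Fin d)
    (ψ : ConfigSpace d G) (j : G → Fin d) :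
    unitOp Λ u v ψ j = if restr Λ j = u then ψ (override Λ v j) else 0 := by
  rw [unitOp, compOp_apply]
  split_ifs with h
  · simp [swapConfig, h]
  · simp

open scoped Classical in
lemma inner_unitOp {d : ℕ} {G : Type*} (Λ : Finset G) (u v : Λ → Fin d)
    (φ ψ : ConfigSpace d G) :
    inner ℂ (unitOp Λ u v φ) ψ = inner ℂ φ (unitOp Λ v u ψ) := by
  rw [lp.inner_eq_tsum, lp.inner_eq_tsum, ← (swapConfig Λ u v).tsum_eq]
  refine tsum_congr fun j => ?_
  rw [unitOp_apply, unitOp_apply]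
  by_cases h : restr Λ j = v
  · subst h
    simp [swapConfig, restr_override, override_override, override_restr]
  · have : Equiv.swap u v (restr Λ j) ≠ u := fun e => h (by
      simpa using congrArg (Equiv.swap u v) e)
    simp [swapConfig, h, restr_override, this]

open scoped Classical in
/-- The operator `M ⊗ 1` on the configuration space for a matrix `M` at the sites of `Λ`. -/
def localOp {d : ℕ} {G : Type*} (Λ : Finset G) (M : Matrix (Λ → Fin d) (Λ → Fin d) ℂ) :
    ConfigSpace d G →L[ℂ] ConfigSpace d G :=
  ∑ u, ∑ v, M u v • unitOp Λ u v

open scoped Classical in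
lemma localOp_apply {d : ℕ} {G : Type*} (Λ : Finset G) (M : Matrix (Λ → Fin d) (Λ → Fin d) ℂ)
    (ψ : ConfigSpace d G) (j : G → Fin d) :
    localOp Λ M ψ j = ∑ v, M (restr Λ j) v * ψ (override Λ v j) := by
  have : localOp Λ M ψ j = ∑ u, ∑ v, M u v * unitOp Λ u v ψ j := by
    simp only [localOp, _root_.sum_apply, lp.coeFn_sum, Finset.sum_apply,
      _root_.smul_apply, lp.coeFn_smul, Pi.smul_apply, smul_eq_mul]
  rw [this, Finset.sum_eq_single (restr Λ j)]
  · simp [unitOp_apply]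
  · intro u _ hu
    simp [unitOp_apply, Ne.symm hu]
  · simp

open scoped Classical in
/-- The representation of the full matrix algebra `𝒮^{⊗Λ}` on the configuration space. -/
def localRep (d : ℕ) {G : Type*} (Λ : Finset G) :
    Matrix (Λ → Fin d) (Λ → Fin d) ℂ →⋆ₐ[ℂ] (ConfigSpace d G →L[ℂ] ConfigSpace d G) where
  toFun := localOp Λ
  map_one' := by
    ext ψ j
    simp [localOp_apply, Matrix.one_apply, override_restr]
  map_mul' M N := by
    ext ψ j
    simp only [mul_apply_eq_comp, localOp_apply, Matrix.mul_apply, restr_override,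
      override_override, Finset.sum_mul, Finset.mul_sum]
    rw [Finset.sum_comm]
    simp only [mul_assoc]
  map_zero' := by
    ext ψ j; simp [localOp_apply]
  map_add' M N := by
    ext ψ j; simp [localOp_apply, add_mul, Finset.sum_add_distrib]
  commutes' c := by
    ext ψ j
    simp [localOp_apply, Algebra.algebraMap_eq_smul_one, Matrix.one_apply, override_restr]
  map_star' M := by
    rw [ContinuousLinearMap.star_eq_adjoint, ContinuousLinearMap.eq_adjoint_iff]
    intro φ ψ
    simp only [localOp, _root_.sum_apply, sum_inner, inner_sum,
      _root_.smul_apply, inner_smul_left, inner_smul_right, inner_unitOp,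
      Matrix.star_apply]
    rw [Finset.sum_comm]
    simp

/-! ### The algebra of quasi-local observables -/

open scoped Classical in
/-- The norm closure of the union of the local matrix algebras. -/
def quasiLocal (d : ℕ) (G : Type*) : StarSubalgebra ℂ (ConfigSpace d G →L[ℂ] ConfigSpace d G) :=
  (⨆ Λ : Finset G, (localRep d Λ).range).topologicalClosure

/-- The UHF algebra `𝒮^{⊗G}`, with `𝒮` the algebra of complex `d × d` matrices. -/
def SpinAlgebra (d : ℕ) (G : Type*) : Type _ := quasiLocal d G

instance (d : ℕ) (G : Type*) : CStarAlgebra (SpinAlgebra d G) :=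
  haveI : IsClosed (quasiLocal d G : Set (ConfigSpace d G →L[ℂ] ConfigSpace d G)) :=
    StarSubalgebra.isClosed_topologicalClosure _
  inferInstanceAs (CStarAlgebra (quasiLocal d G))

/-- The standard partial order of a `C⋆`-algebra. -/
instance (d : ℕ) (G : Type*) : PartialOrder (SpinAlgebra d G) := CStarAlgebra.spectralOrder _

instance (d : ℕ) (G : Type*) : StarOrderedRing (SpinAlgebra d G) :=
  CStarAlgebra.spectralOrderedRing _

/-- The inclusion of `𝒮^{⊗G}` into the bounded operators on the configuration space. -/
def incl (d : ℕ) (G : Type*) :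
    SpinAlgebra d G →⋆ₐ[ℂ] (ConfigSpace d G →L[ℂ] ConfigSpace d G) :=
  (quasiLocal d G).subtype

lemma incl_injective (d : ℕ) (G : Type*) : Function.Injective (incl d G) :=
  Subtype.val_injective

open scoped Classical in
lemma localRep_mem (d : ℕ) {G : Type*} (Λ : Finset G) (M : Matrix (Λ → Fin d) (Λ → Fin d) ℂ) :
    localRep d Λ M ∈ quasiLocal d G :=
  StarSubalgebra.le_topologicalClosure _
    (le_iSup (fun Λ : Finset G => (localRep d Λ).range) Λ ⟨M, rfl⟩)

open scoped Classical in
/-- The canonical embedding of `𝒮^{⊗Λ}` into `𝒮^{⊗G}`. -/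
def localEmb (d : ℕ) {G : Type*} (Λ : Finset G) :
    Matrix (Λ → Fin d) (Λ → Fin d) ℂ →⋆ₐ[ℂ] SpinAlgebra d G :=
  (localRep d Λ).codRestrict (quasiLocal d G) (localRep_mem d Λ)

open scoped Classical in
/-- The subalgebra `𝒮_Λ` of the observables localized in `Λ`. -/
def localAlgebra (d : ℕ) {G : Type*} (Λ : Finset G) : StarSubalgebra ℂ (SpinAlgebra d G) :=
  (localEmb d Λ).range

open scoped Classical in
lemma localEmb_injective (d : ℕ) [NeZero d] {G : Type*} (Λ : Finset G) :
    Function.Injective (localEmb d Λ) := by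
  rw [injective_iff_map_eq_zero]
  intro M hM
  have h : localOp Λ M = 0 := congrArg (incl d G) hM
  ext u v
  have := congrArg (fun T : ConfigSpace d G →L[ℂ] ConfigSpace d G =>
    T (lp.single 2 (override Λ v 0) (1 : ℂ)) (override Λ u 0)) h
  simp only [localOp_apply, restr_override, override_override] at this
  rw [Finset.sum_eq_single v] at this
  · simpa using this
  · intro w _ hw
    rw [lp.single_apply_ne, mul_zero]
    intro e
    exact hw (by simpa [restr_override] using congrArg (restr Λ) e)
  · simp

/-! ### The action of the group -/

/-- The permutation `(β_g j)(x) = j (g · x)` of the configurations, where `g · x = x g⁻¹`. -/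
def shiftConfig (d : ℕ) {G : Type*} [Group G] (g : G) : Equiv.Perm (G → Fin d) where
  toFun j := fun x => j (x * g⁻¹)
  invFun j := fun x => j (x * g)
  left_inv j := by funext x; simp
  right_inv j := by funext x; simp

/-- The unitary `(U_g ψ)(j) = ψ (β_g j)`. -/
def shiftOp (d : ℕ) {G : Type*} [Group G] (g : G) : ConfigSpace d G →L[ℂ] ConfigSpace d G :=
  compOp 1 (by simp) (shiftConfig d g)

lemma shiftOp_apply (d : ℕ) {G : Type*} [Group G] (g : G) (ψ : ConfigSpace d G)
    (j : G → Fin d) : shiftOp d g ψ j = ψ (fun x => j (x * g⁻¹)) := by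
  rw [shiftOp, compOp_apply]; simp [shiftConfig]

lemma shiftOp_one (d : ℕ) {G : Type*} [Group G] : shiftOp d (1 : G) = 1 := by
  ext ψ j; simp [shiftOp_apply]

lemma shiftOp_mul (d : ℕ) {G : Type*} [Group G] (g h : G) :
    shiftOp d (g * h) = shiftOp d g * shiftOp d h := by
  ext ψ j; simp [shiftOp_apply, mul_assoc, mul_apply_eq_comp]

lemma star_shiftOp (d : ℕ) {G : Type*} [Group G] (g : G) :
    star (shiftOp d g) = shiftOp d g⁻¹ := by
  symm
  rw [ContinuousLinearMap.star_eq_adjoint, ContinuousLinearMap.eq_adjoint_iff]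
  intro φ ψ
  rw [lp.inner_eq_tsum, lp.inner_eq_tsum, ← (shiftConfig d g).tsum_eq]
  refine tsum_congr fun j => ?_
  simp [shiftOp_apply, shiftConfig]

/-- The unitary representation `g ↦ U_g` of the group on the configuration space. -/
def shiftUnitary (d : ℕ) (G : Type*) [Group G] :
    G →* unitary (ConfigSpace d G →L[ℂ] ConfigSpace d G) where
  toFun g := ⟨shiftOp d g, by
    rw [Unitary.mem_iff, star_shiftOp, ← shiftOp_mul, ← shiftOp_mul]
    simp [shiftOp_one]⟩
  map_one' := Subtype.ext (shiftOp_one d)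
  map_mul' g h := Subtype.ext (shiftOp_mul d g h)

/-- The right action `g · Λ = Λ g⁻¹` of the group on its finite subsets. -/
def translate {G : Type*} [Group G] (g : G) (Λ : Finset G) : Finset G :=
  Λ.map (Equiv.mulRight g⁻¹).toEmbedding

lemma mem_translate {G : Type*} [Group G] {g : G} {Λ : Finset G} {x : G} :
    x ∈ translate g Λ ↔ x * g ∈ Λ := by
  simp [translate]

lemma translate_one {G : Type*} [Group G] (Λ : Finset G) : translate 1 Λ = Λ := by
  ext x; simp [mem_translate]

lemma translate_mul {G : Type*} [Group G] (g h : G) (Λ : Finset G) :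
    translate (g * h) Λ = translate g (translate h Λ) := by
  ext x; simp [mem_translate, mul_assoc]

lemma translate_mono {G : Type*} [Group G] (g : G) {Λ₁ Λ₂ : Finset G} (h : Λ₁ ⊆ Λ₂) :
    translate g Λ₁ ⊆ translate g Λ₂ :=
  Finset.map_subset_map.2 h

/-- The translation of the sites of `Λ` onto the sites of `g · Λ`. -/
def siteEquiv {G : Type*} [Group G] (g : G) (Λ : Finset G) : Λ ≃ translate g Λ where
  toFun x := ⟨x * g⁻¹, mem_translate.2 (by simp)⟩
  invFun y := ⟨y * g, mem_translate.1 y.2⟩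
  left_inv x := by simp
  right_inv y := by simp

lemma shift_localOp (d : ℕ) {G : Type*} [Group G] (g : G) (Λ : Finset G)
    (M : Matrix (Λ → Fin d) (Λ → Fin d) ℂ) :
    shiftOp d g * localOp Λ M * star (shiftOp d g) =
      localOp (translate g Λ) (M.submatrix (· ∘ siteEquiv g Λ) (· ∘ siteEquiv g Λ)) := by
  classical
  ext ψ j
  simp only [mul_apply_eq_comp, star_shiftOp, shiftOp_apply, localOp_apply]
  refine Fintype.sum_equiv ((siteEquiv g Λ).arrowCongr (Equiv.refl _)) _ _ fun v => ?_
  congr 2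
  · funext x
    simp
  · refine congrArg (ψ : (G → Fin d) → ℂ) ?_
    funext x
    simp only [override, mem_translate, inv_inv, mul_inv_cancel_right]
    split_ifs <;> rfl

lemma shift_mem (d : ℕ) {G : Type*} [Group G] (g : G)
    {T : ConfigSpace d G →L[ℂ] ConfigSpace d G} (hT : T ∈ quasiLocal d G) :
    Unitary.conjStarAlgAut ℂ _ (shiftUnitary d G g) T ∈ quasiLocal d G := by
  let f : (ConfigSpace d G →L[ℂ] ConfigSpace d G) →⋆ₐ[ℂ]
      (ConfigSpace d G →L[ℂ] ConfigSpace d G) :=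
    (Unitary.conjStarAlgAut ℂ (ConfigSpace d G →L[ℂ] ConfigSpace d G)
      (shiftUnitary d G g)).toStarAlgHom
  have hc : Continuous f :=
    (continuous_const.mul continuous_id).mul continuous_const
  have : quasiLocal d G ≤ (quasiLocal d G).comap f := by
    refine StarSubalgebra.topologicalClosure_minimal (iSup_le fun Λ => ?_)
      ((StarSubalgebra.isClosed_topologicalClosure _).preimage hc)
    rintro _ ⟨M, rfl⟩
    have h := localRep_mem d (translate g Λ)
      (M.submatrix (· ∘ siteEquiv g Λ) (· ∘ siteEquiv g Λ))
    have e := shift_localOp d g Λ M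
    change localOp _ _ ∈ _ at h
    rw [← e] at h
    exact h
  exact this hT

/-- The action `α` of the group on `𝒮^{⊗G}` by automorphisms, `α_g a = U_g a U_g⋆`. -/
def spinAction (d : ℕ) (G : Type*) [Group G] :
    G →* (SpinAlgebra d G ≃⋆ₐ[ℂ] SpinAlgebra d G) :=
  let f : G → (SpinAlgebra d G →⋆ₐ[ℂ] SpinAlgebra d G) := fun g =>
    StarAlgHom.codRestrict
      (((Unitary.conjStarAlgAut ℂ _ (shiftUnitary d G g)).toStarAlgHom).comp (incl d G))
      (quasiLocal d G) (fun a => shift_mem d g a.2)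
  have hf : ∀ g h a, f g (f h a) = f (g * h) a := fun g h a => by
    refine incl_injective d G ?_
    change Unitary.conjStarAlgAut ℂ _ (shiftUnitary d G g)
      (Unitary.conjStarAlgAut ℂ _ (shiftUnitary d G h) (incl d G a)) =
      Unitary.conjStarAlgAut ℂ _ (shiftUnitary d G (g * h)) (incl d G a)
    rw [map_mul, map_mul]
    rfl
  have h1 : ∀ a, f 1 a = a := fun a => by
    refine incl_injective d G ?_
    change Unitary.conjStarAlgAut ℂ _ (shiftUnitary d G 1) (incl d G a) = incl d G a
    rw [map_one, map_one]
    rfl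
  { toFun := fun g => StarAlgEquiv.ofStarAlgHom (f g) (f g⁻¹)
      (StarAlgHom.ext fun a => by
        change f g⁻¹ (f g a) = a
        rw [hf, inv_mul_cancel, h1])
      (StarAlgHom.ext fun a => by
        change f g (f g⁻¹ a) = a
        rw [hf, mul_inv_cancel, h1])
    map_one' := StarAlgEquiv.ext h1
    map_mul' := fun g h => StarAlgEquiv.ext fun a => (hf g h a).symm }

lemma incl_spinAction (d : ℕ) (G : Type*) [Group G] (g : G) (a : SpinAlgebra d G) :
    incl d G (spinAction d G g a) = shiftOp d g * incl d G a * star (shiftOp d g) := rfl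

lemma spinAction_mem (d : ℕ) {G : Type*} [Group G] (g : G) {Λ : Finset G} {a : SpinAlgebra d G}
    (ha : a ∈ localAlgebra d Λ) : spinAction d G g a ∈ localAlgebra d (translate g Λ) := by
  obtain ⟨M, rfl⟩ := ha
  exact ⟨_, incl_injective d G (shift_localOp d g Λ M).symm⟩

/-! ### Frustration-free proper systems of projections -/

/-- The set `𝔉(𝒮^{⊗G})` of the frustration-free proper systems of projections. -/
@[ext]
structure FFSystem (d : ℕ) (G : Type*) where
  proj : Finset G → SpinAlgebra d G
  mem_local : ∀ Λ, proj Λ ∈ localAlgebra d Λ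
  isStarProjection : ∀ Λ, IsStarProjection (proj Λ)
  frustrationFree : ∀ Λ₁ Λ₂, Λ₁ ⊆ Λ₂ →
    proj Λ₁ * proj Λ₂ = proj Λ₁ ∧ proj Λ₂ * proj Λ₁ = proj Λ₁
  proper : ∀ Λ, proj Λ < 1

instance (d : ℕ) (G : Type*) : PartialOrder (FFSystem d G) :=
  PartialOrder.lift FFSystem.proj fun _ _ => FFSystem.ext

lemma FFSystem.le_def {d : ℕ} {G : Type*} {P Q : FFSystem d G} :
    P ≤ Q ↔ ∀ Λ, P.proj Λ ≤ Q.proj Λ := Iff.rfl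

/-- The action `g · {p_Λ} = {α_g (p_{g⁻¹ · Λ})}`. -/
instance (d : ℕ) (G : Type*) [Group G] : MulAction G (FFSystem d G) where
  smul g P :=
    { proj := fun Λ => spinAction d G g (P.proj (translate g⁻¹ Λ))
      mem_local := fun Λ => by
        have := spinAction_mem d g (P.mem_local (translate g⁻¹ Λ))
        rwa [← translate_mul, mul_inv_cancel, translate_one] at this
      isStarProjection := fun Λ => (P.isStarProjection _).map (spinAction d G g)
      frustrationFree := fun Λ₁ Λ₂ h => by
        have := P.frustrationFree _ _ (translate_mono g⁻¹ h)
        rw [← map_mul, ← map_mul, this.1, this.2]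
        exact ⟨rfl, rfl⟩
      proper := fun Λ => by
        have h := (OrderIsoClass.toOrderIso (spinAction d G g)).lt_iff_lt.2
          (P.proper (translate g⁻¹ Λ))
        change spinAction d G g _ < spinAction d G g 1 at h
        rwa [map_one] at h }
  one_smul P := FFSystem.ext (funext fun Λ => by
    change spinAction d G 1 (P.proj (translate 1⁻¹ Λ)) = P.proj Λ
    rw [inv_one, translate_one, map_one]; rfl)
  mul_smul g h P := FFSystem.ext (funext fun Λ => by
    change spinAction d G (g * h) (P.proj (translate (g * h)⁻¹ Λ)) =
      spinAction d G g (spinAction d G h (P.proj (translate h⁻¹ (translate g⁻¹ Λ))))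
    rw [mul_inv_rev, translate_mul, map_mul]; rfl)

lemma FFSystem.smul_proj {d : ℕ} {G : Type*} [Group G] (g : G) (P : FFSystem d G)
    (Λ : Finset G) : (g • P).proj Λ = spinAction d G g (P.proj (translate g⁻¹ Λ)) := rfl

/-! ### Hereditary subalgebras with property (F) -/

/-- A `C⋆`-subalgebra `B` is hereditary if `0 ≤ a ≤ b` and `b ∈ B` imply `a ∈ B`. -/
structure IsHereditary {A : Type*} [CStarAlgebra A] [PartialOrder A] [StarOrderedRing A]
    (B : NonUnitalStarSubalgebra ℂ A) : Prop where
  isClosed : IsClosed (B : Set A)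
  mem_of_le : ∀ a b : A, b ∈ B → 0 ≤ a → a ≤ b → a ∈ B

/-- Property (F): the local elements are dense. -/
def PropertyF {d : ℕ} {G : Type*} (B : NonUnitalStarSubalgebra ℂ (SpinAlgebra d G)) : Prop :=
  (B : Set (SpinAlgebra d G)) =
    closure (⋃ Λ : Finset G, (B : Set (SpinAlgebra d G)) ∩ localAlgebra d Λ)

/-- The set `𝔥^F(𝒮^{⊗G})` of the proper hereditary `C⋆`-subalgebras with property (F). -/
@[ext]
structure FHereditary (d : ℕ) (G : Type*) where
  alg : NonUnitalStarSubalgebra ℂ (SpinAlgebra d G)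
  isHereditary : IsHereditary alg
  proper : alg ≠ ⊤
  propertyF : PropertyF alg

/-- The partial order is inclusion. -/
instance (d : ℕ) (G : Type*) : PartialOrder (FHereditary d G) :=
  PartialOrder.lift FHereditary.alg fun _ _ => FHereditary.ext

lemma FHereditary.le_def {d : ℕ} {G : Type*} {B C : FHereditary d G} :
    B ≤ C ↔ (B.alg : Set (SpinAlgebra d G)) ⊆ C.alg := Iff.rfl

lemma continuous_spinAction (d : ℕ) {G : Type*} [Group G] (g : G) :
    Continuous (spinAction d G g) :=
  (NonUnitalStarAlgHom.isometry (spinAction d G g) (spinAction d G g).injective).continuous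

lemma spinAction_inv_apply (d : ℕ) {G : Type*} [Group G] (g : G) (a : SpinAlgebra d G) :
    spinAction d G g⁻¹ (spinAction d G g a) = a := by
  change (spinAction d G g⁻¹ * spinAction d G g) a = a
  rw [← map_mul, inv_mul_cancel, map_one]; rfl

lemma mem_map_spinAction {d : ℕ} {G : Type*} [Group G] (g : G)
    (B : NonUnitalStarSubalgebra ℂ (SpinAlgebra d G)) (a : SpinAlgebra d G) :
    a ∈ B.map (spinAction d G g) ↔ spinAction d G g⁻¹ a ∈ B := by
  constructor
  · rintro ⟨b, hb, rfl⟩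
    change spinAction d G g⁻¹ (spinAction d G g b) ∈ B
    rwa [spinAction_inv_apply]
  · intro h
    refine ⟨_, h, ?_⟩
    have := spinAction_inv_apply d g⁻¹ a
    rwa [inv_inv] at this

lemma coe_map_spinAction {d : ℕ} {G : Type*} [Group G] (g : G)
    (B : NonUnitalStarSubalgebra ℂ (SpinAlgebra d G)) :
    (B.map (spinAction d G g) : Set (SpinAlgebra d G)) = spinAction d G g⁻¹ ⁻¹' B :=
  Set.ext (mem_map_spinAction g B)

lemma PropertyF.map_spinAction {d : ℕ} {G : Type*} [Group G] (g : G)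
    {B : NonUnitalStarSubalgebra ℂ (SpinAlgebra d G)} (hB : PropertyF B) :
    PropertyF (B.map (spinAction d G g)) := by
  let e : SpinAlgebra d G ≃ₜ SpinAlgebra d G :=
    { toEquiv := (spinAction d G g⁻¹).toEquiv
      continuous_toFun := continuous_spinAction d g⁻¹
      continuous_invFun := by
        refine (continuous_spinAction d g).congr fun a => ?_
        refine (spinAction d G g⁻¹).injective ?_
        exact (spinAction_inv_apply d g a).trans ((spinAction d G g⁻¹).right_inv a).symm }
  have h : e ⁻¹' (B : Set (SpinAlgebra d G)) =
      closure (e ⁻¹' ⋃ Λ : Finset G, (B : Set (SpinAlgebra d G)) ∩ localAlgebra d Λ) := by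
    rw [← e.preimage_closure, ← hB]
  unfold PropertyF
  rw [coe_map_spinAction]
  refine h.trans (congrArg closure ?_)
  ext a
  simp only [Set.mem_preimage, Set.mem_iUnion, Set.mem_inter_iff, SetLike.mem_coe]
  constructor
  · rintro ⟨Λ, hB, hl⟩
    refine ⟨translate g Λ, hB, ?_⟩
    have := spinAction_mem d g hl
    have e1 := spinAction_inv_apply d g⁻¹ a
    rw [inv_inv] at e1
    rwa [show spinAction d G g (e a) = a from e1] at this
  · rintro ⟨Λ, hB, hl⟩
    exact ⟨translate g⁻¹ Λ, hB, spinAction_mem d g⁻¹ hl⟩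

/-- The action `g · B = α_g(B)`. -/
instance (d : ℕ) (G : Type*) [Group G] : MulAction G (FHereditary d G) where
  smul g B :=
    { alg := B.alg.map (spinAction d G g)
      isHereditary :=
        { isClosed := by
            rw [coe_map_spinAction]
            exact B.isHereditary.isClosed.preimage (continuous_spinAction d g⁻¹)
          mem_of_le := fun a b hb ha hab => by
            rw [mem_map_spinAction] at hb ⊢
            refine B.isHereditary.mem_of_le _ _ hb ?_ ?_
            · simpa using OrderHomClass.mono (spinAction d G g⁻¹) ha
            · exact OrderHomClass.mono (spinAction d G g⁻¹) hab }
      proper := fun h => B.proper (NonUnitalStarAlgebra.eq_top_iff.2 fun a => by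
        have : spinAction d G g a ∈ B.alg.map (spinAction d G g) := h ▸ NonUnitalStarAlgebra.mem_top
        rwa [mem_map_spinAction, spinAction_inv_apply] at this)
      propertyF := B.propertyF.map_spinAction g }
  one_smul B := FHereditary.ext (SetLike.ext fun a => by
    change a ∈ B.alg.map (spinAction d G 1) ↔ _
    rw [mem_map_spinAction, inv_one, map_one]; rfl)
  mul_smul g h B := FHereditary.ext (SetLike.ext fun a => by
    change a ∈ B.alg.map (spinAction d G (g * h)) ↔
      a ∈ (B.alg.map (spinAction d G h)).map (spinAction d G g)
    rw [mem_map_spinAction, mem_map_spinAction, mem_map_spinAction, mul_inv_rev, map_mul]; rfl)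

lemma FHereditary.smul_alg {d : ℕ} {G : Type*} [Group G] (g : G) (B : FHereditary d G) :
    (g • B).alg = B.alg.map (spinAction d G g) := rfl

/-- `q` is the projection `p_Λ(B) ∈ 𝒮_Λ`, that is, `B ∩ 𝒮_Λ = q 𝒮_Λ q`. -/
structure IsLocalUnit {d : ℕ} {G : Type*} (B : NonUnitalStarSubalgebra ℂ (SpinAlgebra d G))
    (Λ : Finset G) (q : SpinAlgebra d G) : Prop where
  mem_local : q ∈ localAlgebra d Λ
  isStarProjection : IsStarProjection q
  inter_eq : (B : Set (SpinAlgebra d G)) ∩ localAlgebra d Λ =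
    (fun s => q * s * q) '' (localAlgebra d Λ : Set (SpinAlgebra d G))

end SpinSystem

end

open SpinSystem Filter Topology

/-!
The inverse map sends a system `P = {p_Λ}` to the algebra `stableAlg` of all `a` with `p_Λ a → a`
and `a p_Λ → a`. It is closed because the `p_Λ` are contractions, and hereditary because `‖(1 - p)
a‖² ≤ ‖a‖ ‖(1 - p) b‖` for `0 ≤ a ≤ b` (`norm_proj_mul_sq_le`). It is proper, since `p_Λ → 1` in
norm would force `p_Λ = 1` for some `Λ`, and it has property (F), since `p b p` is local and
stable for every `p = p_Λ` and every local `b`. This description involves no exhausting sequence.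
For such a sequence, `w = ∑ 2^{-m} p_{Λ_m}` is stable, and every `p_{Λ_m}` lies in `w A ∩ A w`
(`exists_eq_mul_of_hasSum`), so `p_{Λ_m} a p_{Λ_m} ∈ w A w` and the algebra is the closure of `w A
w` (`stableAlg_eq_closure_range`).

In the other direction, `B ∩ 𝒮_Λ` is finite-dimensional, and its unit `p_Λ(B)` is the support
projection of `∑ b⋆ b` over a finite spanning set (`exists_unit_inter`); functional calculus keeps
it in `B ∩ 𝒮_Λ` because the spectrum is finite. By heredity `p_Λ(B) a p_Λ(B) ∈ B` for every `a`.
The local units fix the local elements of `B` eventually, so property (F) makes them an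
approximate unit, that is, `B` is contained in the stable algebra of its system; and a stable `a`
is the limit of `p_Λ(B) a p_Λ(B) ∈ B`. Hence the two maps compose to the identity of `B`.
-/

namespace SpinSystem

/-! ### The algebra stabilized by a family of projections -/

section CStar

variable {A : Type*} [CStarAlgebra A]

/-- The `C⋆`-subalgebra of the elements `a` for which `p i * a → a` and `a * p i → a` along `l`. The
projections `p i` themselves need not belong to it. -/
def stableAlg {ι : Type*} (l : Filter ι) (p : ι → A) (hp : ∀ i, IsStarProjection (p i)) :
    NonUnitalStarSubalgebra ℂ A where
  carrier := {a | Tendsto (fun i => p i * a) l (𝓝 a) ∧ Tendsto (fun i => a * p i) l (𝓝 a)}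
  add_mem' {a b} ha hb := by
    refine ⟨?_, ?_⟩
    · simpa only [mul_add] using ha.1.add hb.1
    · simpa only [add_mul] using ha.2.add hb.2
  zero_mem' := by simp [tendsto_const_nhds]
  mul_mem' {a b} ha hb := by
    refine ⟨?_, ?_⟩
    · simpa only [mul_assoc] using ha.1.mul_const b
    · simpa only [mul_assoc] using hb.2.const_mul a
  smul_mem' c a ha := by
    refine ⟨?_, ?_⟩
    · simpa only [mul_smul_comm] using ha.1.const_smul c
    · simpa only [smul_mul_assoc] using ha.2.const_smul c
  star_mem' {a} ha := by
    refine ⟨?_, ?_⟩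
    · simpa only [star_mul, (hp _).isSelfAdjoint.star_eq] using ha.2.star
    · simpa only [star_mul, (hp _).isSelfAdjoint.star_eq] using ha.1.star

variable {ι : Type*} {l : Filter ι} {p : ι → A} {hp : ∀ i, IsStarProjection (p i)}

/-- As `a ↦ a⋆` exchanges the two conditions, the one-sided condition is enough for a self-adjoint
element. -/
lemma mem_stableAlg_of_isSelfAdjoint {a : A} (ha : IsSelfAdjoint a)
    (h : Tendsto (fun i => p i * a) l (𝓝 a)) : a ∈ stableAlg l p hp :=
  ⟨h, by simpa only [star_mul, (hp _).isSelfAdjoint.star_eq, ha.star_eq] using h.star⟩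

lemma isClosed_setOf_tendsto_of_lipschitz {E : Type*} [PseudoMetricSpace E] {T : ι → E → E}
    (hT : ∀ i a b, dist (T i a) (T i b) ≤ dist a b) :
    IsClosed {a | Tendsto (fun i => T i a) l (𝓝 a)} := by
  refine isClosed_of_closure_subset fun a ha => Metric.tendsto_nhds.2 fun ε hε => ?_
  obtain ⟨b, hb, hab⟩ := Metric.mem_closure_iff.1 ha (ε / 3) (by positivity)
  filter_upwards [Metric.tendsto_nhds.1 hb (ε / 3) (by positivity)] with i hi
  have h1 := hT i a b
  have h2 := dist_triangle4 (T i a) (T i b) b a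
  rw [dist_comm b a] at h2
  linarith

lemma isClosed_stableAlg : IsClosed (stableAlg l p hp : Set A) := by
  refine (isClosed_setOf_tendsto_of_lipschitz fun i a b => ?_).inter
    (isClosed_setOf_tendsto_of_lipschitz fun i a b => ?_)
  · rw [dist_eq_norm, dist_eq_norm, ← mul_sub]
    exact (norm_mul_le _ _).trans
      (mul_le_of_le_one_left (norm_nonneg _) (IsStarProjection.norm_le _ (hp i)))
  · rw [dist_eq_norm, dist_eq_norm, ← sub_mul]
    exact (norm_mul_le _ _).trans
      (mul_le_of_le_one_right (norm_nonneg _) (IsStarProjection.norm_le _ (hp i)))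

lemma tendsto_mul_mul_of_mem_stableAlg {a : A} (ha : a ∈ stableAlg l p hp) :
    Tendsto (fun i => p i * a * p i) l (𝓝 a) := by
  rw [tendsto_iff_norm_sub_tendsto_zero]
  have h1 := tendsto_iff_norm_sub_tendsto_zero.1 ha.1
  have h2 := tendsto_iff_norm_sub_tendsto_zero.1 ha.2
  have h3 := h1.add h2
  rw [add_zero] at h3
  refine squeeze_zero (fun _ => norm_nonneg _) (fun i => ?_) h3
  calc ‖p i * a * p i - a‖ = ‖(p i * a - a) * p i + (a * p i - a)‖ := by
        congr 1; noncomm_ring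
    _ ≤ ‖(p i * a - a) * p i‖ + ‖a * p i - a‖ := norm_add_le _ _
    _ ≤ ‖p i * a - a‖ + ‖a * p i - a‖ := by
        gcongr
        exact (norm_mul_le _ _).trans
          (mul_le_of_le_one_right (norm_nonneg _) (IsStarProjection.norm_le _ (hp i)))

/-- If `1` were stable, then `‖1 - p i‖ < 1` for some `i`, which forces the projection `1 - p i`
to vanish. -/
lemma one_notMem_stableAlg [l.NeBot] (hp1 : ∀ i, p i ≠ 1) : (1 : A) ∉ stableAlg l p hp := by
  intro h
  obtain ⟨i, hi⟩ := (Metric.tendsto_nhds.1 h.1 1 one_pos).exists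
  rw [mul_one, dist_comm, dist_eq_norm] at hi
  refine hp1 i ?_
  have he := (hp i).one_sub
  have h1 : ‖1 - p i‖ = ‖1 - p i‖ * ‖1 - p i‖ := by
    rw [← CStarRing.norm_star_mul_self, he.isSelfAdjoint.star_eq, he.isIdempotentElem.eq]
  have h2 : ‖1 - p i‖ = 0 := by nlinarith [norm_nonneg (1 - p i)]
  exact (sub_eq_zero.1 (norm_eq_zero.1 h2)).symm

/-- If `p i ≤ r i`, then `(1 - r i) a = (1 - r i) (1 - p i) a` is at most as large as
`(1 - p i) a`. -/
lemma stableAlg_mono {r : ι → A} {hr : ∀ i, IsStarProjection (r i)}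
    (h : ∀ i, r i * p i = p i) : stableAlg l p hp ≤ stableAlg l r hr := by
  have key : ∀ a : A, Tendsto (fun i => p i * a) l (𝓝 a) →
      Tendsto (fun i => r i * a) l (𝓝 a) := fun a ha => by
    rw [tendsto_iff_norm_sub_tendsto_zero] at ha ⊢
    refine squeeze_zero (fun _ => norm_nonneg _) (fun i => ?_) ha
    have e : r i * a - a = (1 - r i) * (p i * a - a) := by
      have : (1 - r i) * p i = 0 := by rw [sub_mul, one_mul, h, sub_self]
      rw [mul_sub, ← mul_assoc, this]; noncomm_ring
    rw [e]
    exact (norm_mul_le _ _).trans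
      (mul_le_of_le_one_left (norm_nonneg _) (IsStarProjection.norm_le _ (hr i).one_sub))
  refine fun a ha => ⟨key a ha.1, ?_⟩
  have := (key _ (star_mem ha).1).star
  simpa only [star_mul, (hr _).isSelfAdjoint.star_eq, star_star] using this

lemma mul_mul_mem_stableAlg {w : A} (hw : w ∈ stableAlg l p hp) (a : A) :
    w * a * w ∈ stableAlg l p hp :=
  ⟨by simpa only [mul_assoc] using hw.1.mul_const (a * w),
    by simpa only [mul_assoc] using hw.2.const_mul (w * a)⟩

lemma proj_mem_stableAlg {κ : Type*} [Preorder κ] {p : κ → A} {hp : ∀ i, IsStarProjection (p i)}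
    (hpp : ∀ i j, i ≤ j → p i * p j = p i ∧ p j * p i = p i) (i : κ) :
    p i ∈ stableAlg atTop p hp := by
  refine ⟨?_, ?_⟩ <;> refine tendsto_const_nhds.congr' ?_ <;>
    filter_upwards [eventually_ge_atTop i] with j hj
  · exact (hpp i j hj).2.symm
  · exact (hpp i j hj).1.symm

/-! ### Weighted sums of increasing sequences of projections -/

section Series

variable {p : ℕ → A}

lemma hasSum_geometric_two_inv : HasSum (fun m : ℕ => (2 : ℂ)⁻¹ ^ (m + 1)) 1 := by
  have h := (hasSum_geometric_of_norm_lt_one (ξ := (2 : ℂ)⁻¹) (by norm_num)).mul_left (2 : ℂ)⁻¹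
  have e : (2 : ℂ)⁻¹ * (1 - 2⁻¹)⁻¹ = 1 := by norm_num
  rw [e] at h
  simpa only [pow_succ'] using h

lemma summable_two_inv_smul (hp : ∀ i, IsStarProjection (p i)) :
    Summable fun m : ℕ => ((2 : ℂ)⁻¹ ^ (m + 1)) • p m := by
  refine Summable.of_norm_bounded hasSum_geometric_two_inv.summable.norm fun m => ?_
  rw [norm_smul]
  exact mul_le_of_le_one_right (norm_nonneg _) (IsStarProjection.norm_le _ (hp m))

/-- Since `w p_m = ∑_{k < m} 2^{-(k+1)} p_k + 2^{-m} p_m`, an induction on `m` shows that `p_m` lies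
in the right ideal `w A`. -/
lemma exists_eq_mul_of_hasSum (hpp : ∀ i j, i ≤ j → p i * p j = p i ∧ p j * p i = p i)
    {w : A} (hw : HasSum (fun m : ℕ => ((2 : ℂ)⁻¹ ^ (m + 1)) • p m) w) (m : ℕ) :
    ∃ c, p m = w * c := by
  induction m using Nat.strong_induction_on with
  | _ m ih =>
    have h1 : HasSum (fun k : ℕ => ((2 : ℂ)⁻¹ ^ (k + m + 1)) • p m)
        (w * p m - ∑ k ∈ Finset.range m, ((2 : ℂ)⁻¹ ^ (k + 1)) • p k) := by
      have h := (hasSum_nat_add_iff' m).2 (hw.mul_right (p m))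
      have e : ∀ k ∈ Finset.range m, ((2 : ℂ)⁻¹ ^ (k + 1)) • p k * p m =
          ((2 : ℂ)⁻¹ ^ (k + 1)) • p k := fun k hk => by
        rw [smul_mul_assoc, (hpp k m (Finset.mem_range.1 hk).le).1]
      rw [Finset.sum_congr rfl e] at h
      refine h.congr_fun fun k => ?_
      rw [smul_mul_assoc, (hpp m (k + m) (Nat.le_add_left _ _)).2]
    have h2 : HasSum (fun k : ℕ => ((2 : ℂ)⁻¹ ^ (k + m + 1)) • p m)
        (((2 : ℂ)⁻¹ ^ m) • p m) := by
      have := (hasSum_geometric_two_inv.mul_left ((2 : ℂ)⁻¹ ^ m)).smul_const (p m)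
      rw [mul_one] at this
      convert this using 3 with k
      ring
    have h3 := h1.unique h2
    choose! c hc using ih
    have h4 : ∑ k ∈ Finset.range m, ((2 : ℂ)⁻¹ ^ (k + 1)) • p k =
        w * ∑ k ∈ Finset.range m, ((2 : ℂ)⁻¹ ^ (k + 1)) • c k := by
      rw [Finset.mul_sum]
      refine Finset.sum_congr rfl fun k hk => ?_
      rw [mul_smul_comm, ← hc k (Finset.mem_range.1 hk)]
    rw [h4, ← mul_sub] at h3
    refine ⟨(2 : ℂ) ^ m • (p m - ∑ k ∈ Finset.range m, ((2 : ℂ)⁻¹ ^ (k + 1)) • c k), ?_⟩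
    rw [mul_smul_comm, h3, smul_smul, ← mul_pow]
    simp

/-- The algebra of an increasing family of projections is the hereditary subalgebra generated by the
weighted sum `w` along a cofinal sequence. -/
lemma stableAlg_eq_closure_range {κ : Type*} [Preorder κ]
    {p : κ → A} {hp : ∀ i, IsStarProjection (p i)}
    (hpp : ∀ i j, i ≤ j → p i * p j = p i ∧ p j * p i = p i) {s : ℕ → κ} (hs : Monotone s)
    (hs' : Tendsto s atTop atTop) {w : A}
    (hw : HasSum (fun m : ℕ => ((2 : ℂ)⁻¹ ^ (m + 1)) • p (s m)) w) :
    (stableAlg atTop p hp : Set A) = closure (Set.range fun a : A => w * a * w) := by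
  have hwm : w ∈ stableAlg atTop p hp := by
    refine isClosed_stableAlg.mem_of_tendsto hw (Eventually.of_forall fun t => ?_)
    exact sum_mem fun m _ => SMulMemClass.smul_mem _ (proj_mem_stableAlg hpp (s m))
  have hws : star w = w := by
    have h := hw.star
    simp only [star_smul, (hp _).isSelfAdjoint.star_eq] at h
    refine h.unique (by simpa using hw)
  refine Set.Subset.antisymm (fun b hb => ?_) (closure_minimal ?_ isClosed_stableAlg)
  · refine mem_closure_of_tendsto ((tendsto_mul_mul_of_mem_stableAlg hb).comp hs')
      (Eventually.of_forall fun m => ?_)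
    obtain ⟨c, hc⟩ := exists_eq_mul_of_hasSum (p := fun m => p (s m))
      (fun i j hij => hpp _ _ (hs hij)) hw m
    have hc' : p (s m) = star c * w := by
      rw [← (hp (s m)).isSelfAdjoint.star_eq, hc, star_mul, hws]
    refine ⟨c * b * star c, ?_⟩
    change w * (c * b * star c) * w = p (s m) * b * p (s m)
    nth_rewrite 1 [hc]
    rw [hc']
    simp only [mul_assoc]
  · rintro _ ⟨a, rfl⟩
    exact mul_mul_mem_stableAlg hwm a

end Series

/-! ### Support projections and hereditary subalgebras -/

/-- The minimal polynomial of `h` over `ℂ` annihilates every spectral value. -/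
lemma finite_spectrum_of_mem (S : StarSubalgebra ℂ A) [FiniteDimensional ℂ S] {h : A}
    (hh : h ∈ S) : (spectrum ℂ h).Finite := by
  have hint : IsIntegral ℂ (⟨h, hh⟩ : S) := Algebra.IsIntegral.isIntegral _
  have h0 : Polynomial.aeval h (minpoly ℂ (⟨h, hh⟩ : S)) = 0 := by
    have := congrArg S.subtype (minpoly.aeval ℂ (⟨h, hh⟩ : S))
    rwa [map_zero, ← StarAlgHom.coe_toAlgHom, ← Polynomial.aeval_algHom_apply] at this
  refine (Polynomial.rootSet_finite (minpoly ℂ (⟨h, hh⟩ : S)) ℂ).subset fun k hk => ?_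
  have := spectrum.subset_polynomial_aeval h (minpoly ℂ (⟨h, hh⟩ : S)) ⟨k, hk, rfl⟩
  rw [h0] at this
  have hA : Nontrivial A := by
    by_contra hA
    rw [not_nontrivial_iff_subsingleton] at hA
    simp [spectrum.of_subsingleton] at hk
  rw [spectrum.zero_eq] at this
  rw [Polynomial.mem_rootSet]
  exact ⟨minpoly.ne_zero hint,
    by simpa [Polynomial.aeval_def, Polynomial.eval₂_eq_eval_map] using this⟩

/-- A self-adjoint element with finite spectrum has a support projection, which lies in every closed
`⋆`-subalgebra containing the element: apply the function `1_{x ≠ 0}`. -/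
lemma exists_support_projection {h : A} (hh : IsSelfAdjoint h) (hfin : (spectrum ℂ h).Finite) :
    ∃ q : A, IsStarProjection q ∧ h * q = h ∧
      ∀ C : NonUnitalStarSubalgebra ℂ A, IsClosed (C : Set A) → h ∈ C → q ∈ C := by
  classical
  have hfin' : (quasispectrum ℝ h).Finite := by
    rw [quasispectrum_eq_spectrum_union_zero]
    refine Set.Finite.union ?_ (Set.finite_singleton 0)
    rw [← spectrum.preimage_algebraMap ℂ]
    exact hfin.preimage (algebraMap ℝ ℂ).injective.injOn
  have hc : ∀ f : ℝ → ℝ, ContinuousOn f (quasispectrum ℝ h) := fun f => hfin'.continuousOn f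
  let f : ℝ → ℝ := fun x => if x = 0 then 0 else 1
  have f0 : f 0 = 0 := if_pos rfl
  refine ⟨cfcₙ f h, ⟨?_, cfcₙ_predicate f h⟩, ?_, fun C hC hm => ?_⟩
  · change cfcₙ f h * cfcₙ f h = _
    rw [← cfcₙ_mul f f h (hc _) f0 (hc _) f0]
    congr 1; funext x; simp [f]
  · conv_lhs => enter [1]; rw [← cfcₙ_id ℝ h]
    rw [← cfcₙ_mul id f h (hc _) rfl (hc _) f0]
    conv_rhs => rw [← cfcₙ_id ℝ h]
    congr 1; funext x; by_cases hx : x = 0 <;> simp [f, hx]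
  · exact cfcₙ_mem (hs := hC) f hm

variable [PartialOrder A] [StarOrderedRing A]

/-- For `0 ≤ a ≤ b` and a projection `e`: `‖e a‖² = ‖e a² e‖ ≤ ‖a‖ ‖e a e‖ ≤ ‖a‖ ‖e b e‖`. -/
lemma norm_proj_mul_sq_le {e a b : A} (he : IsStarProjection e) (ha : 0 ≤ a) (hab : a ≤ b) :
    ‖e * a‖ ^ 2 ≤ ‖a‖ * ‖e * b‖ := by
  have hs := he.isSelfAdjoint.star_eq
  have hsa : IsSelfAdjoint a := IsSelfAdjoint.of_nonneg ha
  have h1 : a * a ≤ ‖a‖ • a := by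
    have h := CStarAlgebra.star_left_conjugate_le_norm_smul (a := CFC.sqrt a) (b := a) hsa
    have hq : IsSelfAdjoint (CFC.sqrt a) := IsSelfAdjoint.of_nonneg (CFC.sqrt_nonneg a)
    have e0 : CFC.sqrt a * CFC.sqrt a = a := CFC.sqrt_mul_sqrt_self a
    have e1 : CFC.sqrt a * a * CFC.sqrt a = a * a := by
      calc CFC.sqrt a * a * CFC.sqrt a
          = CFC.sqrt a * (CFC.sqrt a * CFC.sqrt a) * CFC.sqrt a := by rw [e0]
        _ = (CFC.sqrt a * CFC.sqrt a) * (CFC.sqrt a * CFC.sqrt a) := by simp only [mul_assoc]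
        _ = a * a := by rw [e0]
    rwa [hq.star_eq, e0, e1] at h
  have h2 : a * a ≤ ‖a‖ • b := h1.trans (smul_le_smul_of_nonneg_left hab (norm_nonneg a))
  have h3 : e * (a * a) * e ≤ ‖a‖ • (e * b * e) := by
    have := star_left_conjugate_le_conjugate h2 e
    rwa [hs, mul_smul_comm, smul_mul_assoc] at this
  have h4 : e * (a * a) * e = e * a * star (e * a) := by
    rw [star_mul, hs, hsa.star_eq]; simp only [mul_assoc]
  rw [h4] at h3
  have h5 := CStarAlgebra.norm_le_norm_of_nonneg_of_le (mul_star_self_nonneg _) h3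
  rw [CStarRing.norm_self_mul_star, norm_smul, norm_norm] at h5
  rw [sq]
  refine h5.trans (mul_le_mul_of_nonneg_left ?_ (norm_nonneg _))
  exact (norm_mul_le _ _).trans
    (mul_le_of_le_one_right (norm_nonneg _) (IsStarProjection.norm_le _ he))

lemma isHereditary_stableAlg : IsHereditary (stableAlg l p hp) where
  isClosed := isClosed_stableAlg
  mem_of_le a b hb ha hab := by
    refine mem_stableAlg_of_isSelfAdjoint (IsSelfAdjoint.of_nonneg ha) ?_
    have hb0 : Tendsto (fun i => ‖a‖ * ‖(1 - p i) * b‖) l (𝓝 0) := by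
      have := ((tendsto_const_nhds (x := b)).sub hb.1).norm.const_mul ‖a‖
      simpa [sub_mul] using this
    have h2 : Tendsto (fun i => ‖(1 - p i) * a‖ ^ 2) l (𝓝 0) :=
      squeeze_zero (fun _ => by positivity)
        (fun i => norm_proj_mul_sq_le (hp i).one_sub ha hab) hb0
    have h3 : Tendsto (fun i => ‖(1 - p i) * a‖) l (𝓝 0) := by
      simpa [Real.sqrt_sq] using h2.sqrt
    rw [tendsto_iff_norm_sub_tendsto_zero]
    refine h3.congr fun i => ?_
    rw [norm_sub_rev, sub_mul, one_mul]

/-- For `a ≥ 0` this holds because `q a q ≤ ‖a‖ q`, and the positive elements span `A`. -/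
lemma IsHereditary.conj_mem {B : NonUnitalStarSubalgebra ℂ A} (hB : IsHereditary B) {q : A}
    (hq : IsStarProjection q) (hqB : q ∈ B) (a : A) : q * a * q ∈ B := by
  have ha : a ∈ Submodule.span ℂ {a : A | 0 ≤ a} := by
    rw [CStarAlgebra.span_nonneg]; trivial
  have hs := hq.isSelfAdjoint.star_eq
  induction ha using Submodule.span_induction with
  | mem a ha =>
    refine hB.mem_of_le _ (‖a‖ • q) ?_ ?_ ?_
    · rw [← Complex.coe_smul]; exact SMulMemClass.smul_mem _ hqB
    · have := star_left_conjugate_nonneg ha q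
      rwa [hs] at this
    · have := CStarAlgebra.star_left_conjugate_le_norm_smul (a := q) (b := a)
        (IsSelfAdjoint.of_nonneg ha)
      rwa [hs, hq.isIdempotentElem.eq] at this
  | zero => simp
  | add x y _ _ hx hy => rw [mul_add, add_mul]; exact add_mem hx hy
  | smul c x _ hx => rw [mul_smul_comm, smul_mul_assoc]; exact SMulMemClass.smul_mem _ hx

/-- A finite-dimensional piece `B ∩ S` of a closed `⋆`-subalgebra has a unit, the support projection
of `∑ b⋆ b` over a finite set spanning `B ∩ S`. -/
lemma exists_unit_inter (S : StarSubalgebra ℂ A) [FiniteDimensional ℂ S]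
    (B : NonUnitalStarSubalgebra ℂ A) (hB : IsClosed (B : Set A)) :
    ∃ q : A, IsStarProjection q ∧ q ∈ B ∧ q ∈ S ∧
      ∀ b ∈ B, b ∈ S → q * b = b ∧ b * q = b := by
  let C : NonUnitalStarSubalgebra ℂ A := B ⊓ S.toNonUnitalStarSubalgebra
  have hS : IsClosed (S : Set A) :=
    Submodule.closed_of_finiteDimensional (S.toSubalgebra.toSubmodule)
  have hC : IsClosed (C : Set A) := hB.inter hS
  have hfg : C.toSubmodule.FG := by
    have : FiniteDimensional ℂ (Subalgebra.toSubmodule S.toSubalgebra) :=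
      inferInstanceAs (FiniteDimensional ℂ S)
    exact (Submodule.finiteDimensional_of_le (S₂ := Subalgebra.toSubmodule S.toSubalgebra)
      (fun x (hx : x ∈ C) => hx.2)) |>.fg_top |> (Submodule.fg_top _).1
  obtain ⟨t, ht⟩ := hfg
  have htC : ∀ b ∈ t, b ∈ C := fun b hb => by
    have : b ∈ C.toSubmodule := ht ▸ Submodule.subset_span hb
    exact this
  let h : A := ∑ b ∈ t, star b * b
  have hh : IsSelfAdjoint h := IsSelfAdjoint.of_nonneg
    (Finset.sum_nonneg fun b _ => star_mul_self_nonneg b)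
  have hmem : h ∈ C := sum_mem fun b hb => mul_mem (star_mem (htC b hb)) (htC b hb)
  obtain ⟨q, hq, hhq, hqC⟩ := exists_support_projection hh (finite_spectrum_of_mem S hmem.2)
  have hqC := hqC C hC hmem
  have hqs := hq.isSelfAdjoint.star_eq
  -- `0 ≤ (1 - q) b⋆ b (1 - q) ≤ (1 - q) h (1 - q) = 0`, so `b (1 - q) = 0`.
  have hz : ∀ b ∈ t, b * q = b := fun b hb => by
    have h1 : (1 - q) * h * (1 - q) = 0 := by rw [mul_assoc, mul_sub, mul_one, hhq]; simp
    have h2 : (1 - q) * (star b * b) * (1 - q) ≤ (1 - q) * h * (1 - q) := by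
      have := star_left_conjugate_le_conjugate
        (Finset.single_le_sum (f := fun b => star b * b) (fun b _ => star_mul_self_nonneg b) hb)
        (1 - q)
      rwa [star_sub, star_one, hqs] at this
    have h3 : (1 - q) * (star b * b) * (1 - q) = star (b * (1 - q)) * (b * (1 - q)) := by
      rw [star_mul, star_sub, star_one, hqs]; simp only [mul_assoc]
    rw [h1, h3] at h2
    have h4 := CStarRing.star_mul_self_eq_zero_iff _ |>.1
      (le_antisymm h2 (star_mul_self_nonneg _))
    rw [mul_sub, mul_one, sub_eq_zero] at h4
    exact h4.symm
  have hall : ∀ b ∈ C, b * q = b := fun b hb => by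
    have hb' : b ∈ Submodule.span ℂ (t : Set A) := by rw [ht]; exact hb
    induction hb' using Submodule.span_induction with
    | mem b hb' => exact hz b hb'
    | zero => simp
    | add x y hx hy ihx ihy =>
      rw [add_mul, ihx (by rw [ht] at hx; exact hx), ihy (by rw [ht] at hy; exact hy)]
    | smul c x hx ihx => rw [smul_mul_assoc, ihx (by rw [ht] at hx; exact hx)]
  refine ⟨q, hq, hqC.1, hqC.2, fun b hb hbS => ⟨?_, hall b ⟨hb, hbS⟩⟩⟩
  have := congrArg star (hall (star b) (star_mem (s := C) ⟨hb, hbS⟩))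
  rwa [star_mul, star_star, hqs] at this

end CStar

/-! ### Local observables -/

variable {d : ℕ} {G : Type*}

open scoped Classical in
/-- An observable localized in `Λ` acts as the matrix `M ⊗ 1` at the sites of any `Λ' ⊇ Λ`. -/
lemma localAlgebra_mono {Λ Λ' : Finset G} (h : Λ ⊆ Λ') :
    localAlgebra d Λ ≤ localAlgebra d Λ' := by
  rintro _ ⟨M, rfl⟩
  -- `o u w` replaces the values of `u` at the sites of `Λ` by `w`; it describes the nonzero entries
  -- of `M ⊗ 1`.
  let r : (Λ' → Fin d) → (Λ → Fin d) := fun u x => u ⟨x, h x.2⟩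
  let o : (Λ' → Fin d) → (Λ → Fin d) → (Λ' → Fin d) := fun u w x =>
    if hx : (x : G) ∈ Λ then w ⟨x, hx⟩ else u x
  refine ⟨Matrix.of fun u v => ∑ w, M (r u) w * if v = o u w then 1 else 0, ?_⟩
  refine incl_injective d G ?_
  change localOp Λ' _ = localOp Λ M
  ext ψ j
  rw [localOp_apply, localOp_apply]
  simp only [Matrix.of_apply, Finset.sum_mul]
  rw [Finset.sum_comm]
  refine Finset.sum_congr rfl fun w _ => ?_
  rw [Finset.sum_eq_single (o (restr Λ' j) w)]
  · rw [if_pos rfl, mul_one]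
    have h1 : r (restr Λ' j) = restr Λ j := rfl
    have h2 : override Λ' (o (restr Λ' j) w) j = override Λ w j := by
      funext x
      by_cases hx : x ∈ Λ
      · simp [override, o, hx, h hx]
      · by_cases hx' : x ∈ Λ' <;> simp [override, o, hx, hx', restr]
    rw [h1, h2]
  · intro v _ hv
    rw [if_neg hv, mul_zero, zero_mul]
  · simp

instance finiteDimensional_localAlgebra (Λ : Finset G) :
    FiniteDimensional ℂ (localAlgebra d Λ) := by
  classical
  exact Module.Finite.range (localEmb d Λ).toAlgHom.toLinearMap

open scoped Classical in
/-- The local observables are dense: the local algebras are directed, so their supremum is their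
union. -/
lemma exists_local_dist_lt (a : SpinAlgebra d G) {ε : ℝ} (hε : 0 < ε) :
    ∃ Λ : Finset G, ∃ b ∈ localAlgebra d Λ, dist a b < ε := by
  have hdir : Directed (· ≤ ·) fun Λ : Finset G => (localRep d Λ).range := fun Λ₁ Λ₂ => by
    have hm : ∀ {Λ Λ' : Finset G}, Λ ⊆ Λ' → (localRep d Λ).range ≤ (localRep d Λ').range := by
      rintro Λ Λ' h _ ⟨M, rfl⟩
      obtain ⟨N, hN⟩ := localAlgebra_mono (d := d) h ⟨M, rfl⟩
      exact ⟨N, congrArg (incl d G) hN⟩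
    exact ⟨Λ₁ ∪ Λ₂, hm Finset.subset_union_left, hm Finset.subset_union_right⟩
  have ha : incl d G a ∈ closure (↑(⨆ Λ : Finset G, (localRep d Λ).range) : Set _) := a.2
  obtain ⟨b, hb, hab⟩ := Metric.mem_closure_iff.1 ha ε hε
  rw [StarSubalgebra.coe_iSup_of_directed hdir, Set.mem_iUnion] at hb
  obtain ⟨Λ, M, rfl⟩ := hb
  exact ⟨Λ, localEmb d Λ M, ⟨M, rfl⟩, hab⟩

/-! ### From systems of projections to hereditary subalgebras -/

/-- The stable algebra of a system has property (F): `a` is close to `p a p`, hence to `p b p` for a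
local `b`, and `p b p` is local and stable. -/
lemma propertyF_stableAlg (P : FFSystem d G) :
    PropertyF (stableAlg atTop P.proj P.isStarProjection) := by
  refine Set.Subset.antisymm (fun a ha => Metric.mem_closure_iff.2 fun ε hε => ?_)
    (closure_minimal (Set.iUnion_subset fun Λ => Set.inter_subset_left) isClosed_stableAlg)
  obtain ⟨Λ, hΛ⟩ := (Metric.tendsto_nhds.1 (tendsto_mul_mul_of_mem_stableAlg ha) (ε / 2)
    (by positivity)).exists
  obtain ⟨Λ', b, hb, hab⟩ := exists_local_dist_lt a (half_pos hε)
  classical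
  let q := P.proj Λ
  have hq : ‖q‖ ≤ 1 := IsStarProjection.norm_le _ (P.isStarProjection Λ)
  have hqm : q ∈ localAlgebra d (Λ ∪ Λ') :=
    localAlgebra_mono Finset.subset_union_left (P.mem_local Λ)
  refine ⟨q * b * q, Set.mem_iUnion.2 ⟨Λ ∪ Λ', ?_, ?_⟩, ?_⟩
  · exact mul_mul_mem_stableAlg (proj_mem_stableAlg P.frustrationFree Λ) b
  · exact mul_mem (mul_mem hqm (localAlgebra_mono Finset.subset_union_right hb)) hqm
  · have h1 : dist (q * a * q) (q * b * q) ≤ dist a b := by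
      rw [dist_eq_norm, dist_eq_norm, ← sub_mul, ← mul_sub]
      calc ‖q * (a - b) * q‖ ≤ ‖q‖ * ‖a - b‖ * ‖q‖ := norm_mul₃_le
        _ ≤ 1 * ‖a - b‖ * 1 := by gcongr
        _ = ‖a - b‖ := by ring
    have h2 := dist_triangle a (q * a * q) (q * b * q)
    rw [dist_comm] at hΛ
    linarith

/-- The hereditary subalgebra of a system `P`: the `a` with `p_Λ a → a` and `a p_Λ → a`. -/
noncomputable def FFSystem.toFHereditary (P : FFSystem d G) : FHereditary d G where
  alg := stableAlg atTop P.proj P.isStarProjection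
  isHereditary := isHereditary_stableAlg
  proper h := one_notMem_stableAlg (hp := P.isStarProjection) (l := atTop)
    (fun Λ => (P.proper Λ).ne) (h ▸ NonUnitalStarAlgebra.mem_top)
  propertyF := propertyF_stableAlg P

lemma FFSystem.mem_toFHereditary {P : FFSystem d G} {a : SpinAlgebra d G} :
    a ∈ P.toFHereditary.alg ↔ Tendsto (fun Λ => P.proj Λ * a) atTop (𝓝 a) ∧
      Tendsto (fun Λ => a * P.proj Λ) atTop (𝓝 a) := Iff.rfl

lemma FFSystem.toFHereditary_mono : Monotone (toFHereditary : FFSystem d G → FHereditary d G) :=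
  fun P R h => stableAlg_mono (hp := P.isStarProjection) (hr := R.isStarProjection) fun Λ =>
    ((P.isStarProjection Λ).le_iff_mul_eq_right (R.isStarProjection Λ)).1 (h Λ)

lemma FFSystem.exists_hasSum_toFHereditary (P : FFSystem d G) (Λ : ℕ → Finset G)
    (hΛ : Monotone Λ) (hΛ' : ∀ x, ∃ m, x ∈ Λ m) :
    ∃ w : SpinAlgebra d G, HasSum (fun m : ℕ => ((2 : ℂ)⁻¹ ^ (m + 1)) • P.proj (Λ m)) w ∧
      (P.toFHereditary.alg : Set (SpinAlgebra d G)) =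
        closure (Set.range fun a : SpinAlgebra d G => w * a * w) := by
  have hw := (summable_two_inv_smul fun m => P.isStarProjection (Λ m)).hasSum
  exact ⟨_, hw, stableAlg_eq_closure_range (hp := P.isStarProjection) P.frustrationFree hΛ
    (tendsto_atTop_finset_of_monotone hΛ hΛ') hw⟩

section Action

variable [Group G]

lemma spinAction_apply_inv (g : G) (a : SpinAlgebra d G) :
    spinAction d G g (spinAction d G g⁻¹ a) = a := by
  simpa using spinAction_inv_apply d g⁻¹ a

lemma tendsto_translate (g : G) : Tendsto (translate g) atTop atTop := by
  refine tendsto_atTop_atTop.2 fun Λ => ⟨translate g⁻¹ Λ, fun Λ' h => ?_⟩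
  have := translate_mono g h
  rwa [← translate_mul, mul_inv_cancel, translate_one] at this

lemma FFSystem.mem_toFHereditary_smul (g : G) {P : FFSystem d G} {a : SpinAlgebra d G}
    (ha : a ∈ P.toFHereditary.alg) : spinAction d G g a ∈ (g • P).toFHereditary.alg := by
  rw [mem_toFHereditary] at ha ⊢
  simp only [FFSystem.smul_proj, ← map_mul]
  have hc := (continuous_spinAction d g).tendsto a
  exact ⟨(hc.comp ha.1).comp (tendsto_translate g⁻¹),
    (hc.comp ha.2).comp (tendsto_translate g⁻¹)⟩

lemma FFSystem.toFHereditary_smul (g : G) (P : FFSystem d G) :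
    (g • P).toFHereditary = g • P.toFHereditary := by
  refine FHereditary.ext (SetLike.ext fun a => ?_)
  rw [FHereditary.smul_alg, mem_map_spinAction]
  constructor
  · intro h
    simpa only [inv_smul_smul] using FFSystem.mem_toFHereditary_smul g⁻¹ h
  · intro h
    have := FFSystem.mem_toFHereditary_smul g h
    rwa [spinAction_apply_inv] at this

end Action

/-! ### From hereditary subalgebras to systems of projections -/

lemma IsLocalUnit.mem {B : NonUnitalStarSubalgebra ℂ (SpinAlgebra d G)} {Λ : Finset G}
    {q : SpinAlgebra d G} (h : IsLocalUnit B Λ q) : q ∈ B := by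
  have : q ∈ (fun s => q * s * q) '' (localAlgebra d Λ : Set (SpinAlgebra d G)) :=
    ⟨q, h.mem_local, by
      simp only [h.isStarProjection.isIdempotentElem.eq]⟩
  rw [← h.inter_eq] at this
  exact this.1

lemma IsLocalUnit.mul_eq {B : NonUnitalStarSubalgebra ℂ (SpinAlgebra d G)} {Λ : Finset G}
    {q b : SpinAlgebra d G} (h : IsLocalUnit B Λ q) (hb : b ∈ B) (hbl : b ∈ localAlgebra d Λ) :
    q * b = b ∧ b * q = b := by
  have : b ∈ (B : Set (SpinAlgebra d G)) ∩ localAlgebra d Λ := ⟨hb, hbl⟩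
  rw [h.inter_eq] at this
  obtain ⟨s, _, rfl⟩ := this
  have e := h.isStarProjection.isIdempotentElem.eq
  constructor
  · simp only [← mul_assoc, e]
  · simp only [mul_assoc, e]

lemma IsLocalUnit.unique {B : NonUnitalStarSubalgebra ℂ (SpinAlgebra d G)} {Λ : Finset G}
    {q r : SpinAlgebra d G} (hq : IsLocalUnit B Λ q) (hr : IsLocalUnit B Λ r) : q = r :=
  (hr.mul_eq hq.mem hq.mem_local).2.symm.trans (hq.mul_eq hr.mem hr.mem_local).1

lemma FHereditary.exists_isLocalUnit (B : FHereditary d G) (Λ : Finset G) :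
    ∃ q, IsLocalUnit B.alg Λ q := by
  obtain ⟨q, hq, hqB, hqS, hu⟩ :=
    exists_unit_inter (localAlgebra d Λ) B.alg B.isHereditary.isClosed
  refine ⟨q, hqS, hq, Set.Subset.antisymm (fun b hb => ⟨b, hb.2, ?_⟩) ?_⟩
  · obtain ⟨h1, h2⟩ := hu b hb.1 hb.2
    simp only [h1, h2]
  · rintro _ ⟨s, hs, rfl⟩
    exact ⟨B.isHereditary.conj_mem hq hqB s, mul_mem (mul_mem hqS hs) hqS⟩

/-- The projection `p_Λ(B) ∈ 𝒮_Λ`, the unit of `B ∩ 𝒮_Λ`. -/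
noncomputable def FHereditary.unit (B : FHereditary d G) (Λ : Finset G) : SpinAlgebra d G :=
  (B.exists_isLocalUnit Λ).choose

lemma FHereditary.isLocalUnit_unit (B : FHereditary d G) (Λ : Finset G) :
    IsLocalUnit B.alg Λ (B.unit Λ) :=
  (B.exists_isLocalUnit Λ).choose_spec

lemma FHereditary.one_notMem (B : FHereditary d G) : (1 : SpinAlgebra d G) ∉ B.alg := fun h =>
  B.proper (NonUnitalStarAlgebra.eq_top_iff.2 fun a => by
    simpa using B.isHereditary.conj_mem (.one _) h a)

/-- The system `{p_Λ(B)}` of a hereditary subalgebra `B`. -/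
noncomputable def FHereditary.toFFSystem (B : FHereditary d G) : FFSystem d G where
  proj := B.unit
  mem_local Λ := (B.isLocalUnit_unit Λ).mem_local
  isStarProjection Λ := (B.isLocalUnit_unit Λ).isStarProjection
  frustrationFree Λ₁ Λ₂ h :=
    ((B.isLocalUnit_unit Λ₂).mul_eq (B.isLocalUnit_unit Λ₁).mem
      (localAlgebra_mono h (B.isLocalUnit_unit Λ₁).mem_local)).symm
  proper Λ := (B.isLocalUnit_unit Λ).isStarProjection.le_one.lt_of_ne fun h =>
    B.one_notMem (h ▸ (B.isLocalUnit_unit Λ).mem)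

lemma FHereditary.isLocalUnit_iff (B : FHereditary d G) (Λ : Finset G) (q : SpinAlgebra d G) :
    IsLocalUnit B.alg Λ q ↔ q = B.toFFSystem.proj Λ :=
  ⟨fun h => h.unique (B.isLocalUnit_unit Λ), fun h => h ▸ B.isLocalUnit_unit Λ⟩

/-- The local units form an approximate unit of `B`, because they fix the local elements of `B`
eventually, and these are dense. -/
lemma FHereditary.alg_le_toFHereditary (B : FHereditary d G) :
    B.alg ≤ B.toFFSystem.toFHereditary.alg := by
  change (B.alg : Set (SpinAlgebra d G)) ⊆ _
  rw [B.propertyF]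
  refine closure_minimal (Set.iUnion_subset fun Λ b hb => ?_)
    B.toFFSystem.toFHereditary.isHereditary.isClosed
  have hu : ∀ Λ' ≥ Λ, B.unit Λ' * b = b ∧ b * B.unit Λ' = b := fun Λ' h =>
    (B.isLocalUnit_unit Λ').mul_eq hb.1 (localAlgebra_mono h hb.2)
  exact ⟨tendsto_const_nhds.congr' ((eventually_ge_atTop Λ).mono fun Λ' h => (hu Λ' h).1.symm),
    tendsto_const_nhds.congr' ((eventually_ge_atTop Λ).mono fun Λ' h => (hu Λ' h).2.symm)⟩

/-- An element `a` fixed by the local units in the limit is the limit of `p_Λ a p_Λ`, which lies in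
the hereditary subalgebra `B`. -/
lemma FHereditary.toFHereditary_toFFSystem (B : FHereditary d G) :
    B.toFFSystem.toFHereditary = B := by
  refine le_antisymm (fun a ha => ?_) B.alg_le_toFHereditary
  exact B.isHereditary.isClosed.mem_of_tendsto (tendsto_mul_mul_of_mem_stableAlg
    (hp := B.toFFSystem.isStarProjection) ha) (Eventually.of_forall fun Λ => B.isHereditary.conj_mem
      (B.isLocalUnit_unit Λ).isStarProjection (B.isLocalUnit_unit Λ).mem a)

lemma FHereditary.toFFSystem_mono : Monotone (toFFSystem : FHereditary d G → FFSystem d G) :=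
  fun B C h Λ => (B.isLocalUnit_unit Λ).isStarProjection.le_of_mul_eq_right
    (C.isLocalUnit_unit Λ).isStarProjection ((C.isLocalUnit_unit Λ).mul_eq
      (h (B.isLocalUnit_unit Λ).mem) (B.isLocalUnit_unit Λ).mem_local).1

lemma FHereditary.toFFSystem_smul [Group G] (g : G) (B : FHereditary d G) :
    (g • B).toFFSystem = g • B.toFFSystem := by
  refine FFSystem.ext (funext fun Λ => Eq.symm ?_)
  rw [← FHereditary.isLocalUnit_iff, FFSystem.smul_proj, FHereditary.smul_alg]
  have hu := B.isLocalUnit_unit (translate g⁻¹ Λ)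
  have hl : ∀ {a}, a ∈ localAlgebra d (translate g⁻¹ Λ) →
      spinAction d G g a ∈ localAlgebra d Λ := fun ha => by
    have := spinAction_mem d g ha
    rwa [← translate_mul, mul_inv_cancel, translate_one] at this
  refine ⟨hl hu.mem_local, hu.isStarProjection.map (spinAction d G g),
    Set.Subset.antisymm (fun a ha => ?_) ?_⟩
  · have hb := (mem_map_spinAction g B.alg a).1 ha.1
    obtain ⟨h1, h2⟩ := hu.mul_eq hb (spinAction_mem d g⁻¹ ha.2)
    refine ⟨a, ha.2, ?_⟩
    change spinAction d G g (B.unit _) * a * spinAction d G g (B.unit _) = a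
    rw [← spinAction_apply_inv g a, ← map_mul, ← map_mul, h1, h2]
  · rintro _ ⟨s, hs, rfl⟩
    refine ⟨?_, mul_mem (mul_mem (hl hu.mem_local) hs) (hl hu.mem_local)⟩
    refine (mem_map_spinAction g B.alg _).2 ?_
    rw [map_mul, map_mul]
    change spinAction d G g⁻¹ (spinAction d G g (B.unit _)) * _ *
      spinAction d G g⁻¹ (spinAction d G g (B.unit _)) ∈ B.alg
    rw [spinAction_inv_apply]
    exact B.isHereditary.conj_mem hu.isStarProjection hu.mem _

end SpinSystem

theorem mainTheorem1 (d : ℕ) [NeZero d] (G : Type*) [Group G] [Countable G] :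
    ∃ (𝔭 : FHereditary d G → FFSystem d G) (𝔮 : FFSystem d G → FHereditary d G),
      -- `𝔭` sends `B` to its localized approximate unit
      (∀ (B : FHereditary d G) (Λ : Finset G) (q : SpinAlgebra d G),
        IsLocalUnit B.alg Λ q ↔ q = (𝔭 B).proj Λ) ∧
      (∀ (B : FHereditary d G), ∀ b ∈ B.alg,
        Tendsto (fun Λ => (𝔭 B).proj Λ * b) atTop (𝓝 b) ∧
        Tendsto (fun Λ => b * (𝔭 B).proj Λ) atTop (𝓝 b)) ∧
      -- `𝔭` is an injective equivariant morphism of posets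
      Function.Injective 𝔭 ∧
      Monotone 𝔭 ∧
      (∀ (g : G) (B : FHereditary d G), 𝔭 (g • B) = g • 𝔭 B) ∧
      -- `𝔮 = 𝔭⁻¹` sends `P` to the closure of `w 𝒮^{⊗G} w`
      (∀ (P : FFSystem d G) (Λ : ℕ → Finset G), Monotone Λ → (∀ x, ∃ m, x ∈ Λ m) →
        ∃ w : SpinAlgebra d G, HasSum (fun m : ℕ => ((2 : ℂ)⁻¹ ^ (m + 1)) • P.proj (Λ m)) w ∧
          ((𝔮 P).alg : Set (SpinAlgebra d G)) =
            closure (Set.range fun a : SpinAlgebra d G => w * a * w)) ∧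
      -- `𝔮` is an equivariant morphism of posets and a left inverse of `𝔭`
      Monotone 𝔮 ∧
      (∀ (g : G) (P : FFSystem d G), 𝔮 (g • P) = g • 𝔮 P) ∧
      Function.LeftInverse 𝔮 𝔭 := by
  exact ⟨FHereditary.toFFSystem, FFSystem.toFHereditary, FHereditary.isLocalUnit_iff,
    fun B _ hb => FFSystem.mem_toFHereditary.1 (B.alg_le_toFHereditary hb),
    Function.LeftInverse.injective FHereditary.toFHereditary_toFFSystem,
    FHereditary.toFFSystem_mono, FHereditary.toFFSystem_smul,
    FFSystem.exists_hasSum_toFHereditary, FFSystem.toFHereditary_mono,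
    FFSystem.toFHereditary_smul, FHereditary.toFHereditary_toFFSystem⟩
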